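/- Let $\mathcal H$ be a complex Hilbert space and let $A$ be a compact operator on $\mathcal H$ which is not of finite rank. Let $\mu_1(A)\ge\mu_2(A)\ge\cdots>0$ be the nonzero eigenvalues of $|A|$, in non-increasing order and counted with multiplicity. Put $\mu_A(x)=\mu_n(A)$ for $x\in[n,n+1)$, $n=1,2,\dots$, and $f(t)=-\log\mu_A(e^t)$ for $t\ge 0$. A *singular trace* on $\mathcal B(\mathcal H)$ is a map $\tau:\mathcal B(\mathcal H)_+\to[0,\infty]$ which is additive and positively homogeneous, satisfies $\tau(X^*X)=\tau(XX^*)$ for all $X\in\mathcal B(\mathcal H)$, and vanishes on the finite rank projections. A number $\alpha\in(0,\infty)$ is an *exponent of singular traceability* of $A$ if there is a singular trace $\tau$ with $\tau(|A|^\alpha)=1$. The *order of infinitesimal* of $A$ is $$\mathrm{ord}(A)=\liminf_{n\to\infty}\frac{\log\mu_n(A)}{\log(1/n)}\in[0,\infty].$$ **Theorem.** The limits $$\lim_{h\to\infty}\ \limsup_{t\to\infty}\frac{f(t+h)-f(t)}{h},\qquad \lim_{h\to\infty}\ \liminf_{t\to\infty}\frac{f(t+h)-f(t)}{h}$$ exist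 in $[0,\infty]$. Let $\underline c(A)$ and $\overline c(A)$ denote the inverses of the first and of the second limit respectively, with the conventions $0^{-1}=\infty$ and $\infty^{-1}=0$. Then every exponent $\alpha$ of singular traceability of $A$ satisfies $\underline c(A)\le\alpha\le\overline c(A)$. Moreover $$\underline c(A)\le \mathrm{ord}(A)^{-1}\le\overline c(A),$$ with the same conventions for $\mathrm{ord}(A)^{-1}$. -/

import Mathlib

open Filter Topology
open scoped ENNReal NNReal

noncomputable section

namespace SingularTraces

variable {H : Type*} [NormedAddCommGroup H] [InnerProductSpace ℂ H] [CompleteSpace H]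

/-- A tracial weight on `B(H)`: an additive, positively homogeneous map from the positive
bounded operators to `[0, ∞]` with `τ (X* X) = τ (X X*)` for all bounded `X`. It is represented by a
function on all operators of which only the values on positive operators matter. -/
structure IsTracialWeight (τ : (H →L[ℂ] H) → ℝ≥0∞) : Prop where
  map_add : ∀ S T : H →L[ℂ] H, 0 ≤ S → 0 ≤ T → τ (S + T) = τ S + τ T
  map_smul : ∀ (c : ℝ≥0) (T : H →L[ℂ] H), 0 ≤ T → τ ((c : ℂ) • T) = (c : ℝ≥0∞) * τ T
  map_star_mul_self : ∀ X : H →L[ℂ] H, τ (star X * X) = τ (X * star X)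

/-- A singular trace on `B(H)`: a tracial weight vanishing on the finite rank projections. -/
structure IsSingularTrace (τ : (H →L[ℂ] H) → ℝ≥0∞) : Prop extends IsTracialWeight τ where
  map_finiteRank : ∀ P : H →L[ℂ] H, IsStarProjection P →
    FiniteDimensional ℂ (LinearMap.range (P : H →ₗ[ℂ] H)) → τ P = 0

/-- `α ∈ (0, ∞)` is an exponent of singular traceability for `A` if some singular trace takes the
value `1` on `|A| ^ α`. -/
def IsExponentOfSingularTraceability (A : H →L[ℂ] H) (α : ℝ) : Prop :=
  0 < α ∧ ∃ τ : (H →L[ℂ] H) → ℝ≥0∞, IsSingularTrace τ ∧ τ (CFC.rpow (CFC.abs A) α) = 1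

/-- The number of eigenvalues `l > s` of `T` (real `l`), counted with multiplicity: eigenspaces for
different eigenvalues being independent, this is the dimension of the span of these eigenspaces. -/
def eigenvalueCount (T : H →L[ℂ] H) (s : ℝ) : Cardinal :=
  Module.rank ℂ
    ↥(⨆ l : {l : ℝ // s < l}, Module.End.eigenspace (T : H →ₗ[ℂ] H) ((l : ℝ) : ℂ))

/-- `μₙ(A)`, for `n = 1, 2, …`: the `n`-th of the eigenvalues of `|A|`, arranged in non-increasing
order and counted with multiplicity, that is, the least `s ≥ 0` such that fewer than `n`
eigenvalues of `|A|` exceed `s`. (The value at `n = 0` has no meaning and plays no role.) -/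
def mu (A : H →L[ℂ] H) (n : ℕ) : ℝ :=
  sInf {s : ℝ | 0 ≤ s ∧ eigenvalueCount (CFC.abs A) s < (n : Cardinal)}

/-- The locally constant function `μ_A(x) = μₙ(A)` for `x ∈ [n, n + 1)`. -/
def muFun (A : H →L[ℂ] H) (x : ℝ) : ℝ := mu A ⌊x⌋₊

/-- `f_A(t) = -log μ_A(e ^ t)`. -/
def fA (A : H →L[ℂ] H) (t : ℝ) : ℝ := -Real.log (muFun A (Real.exp t))

/-- The order of infinitesimal, with values in `[0, ∞]`. (The quotients are
nonnegative for all large `n`, so the truncation in `ENNReal.ofReal` does not affect the value.) -/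
def ord (A : H →L[ℂ] H) : ℝ≥0∞ :=
  liminf (fun n : ℕ => ENNReal.ofReal (Real.log (mu A n) / Real.log (1 / (n : ℝ)))) atTop

/-- `limsup_{t → ∞} (f_A(t + h) - f_A(t)) / h` in `[0, ∞]`, for `h > 0`. (The quotients are
nonnegative for `t ≥ 0`.) -/
def upperSlope (A : H →L[ℂ] H) (h : ℝ) : ℝ≥0∞ :=
  limsup (fun t : ℝ => ENNReal.ofReal ((fA A (t + h) - fA A t) / h)) atTop

/-- `liminf_{t → ∞} (f_A(t + h) - f_A(t)) / h` in `[0, ∞]`, for `h > 0`. -/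
def lowerSlope (A : H →L[ℂ] H) (h : ℝ) : ℝ≥0∞ :=
  liminf (fun t : ℝ => ENNReal.ofReal ((fA A (t + h) - fA A t) / h)) atTop

/-- The lower bound `c̲(A)`, in `[0, ∞]` with `0⁻¹ = ∞` and `∞⁻¹ = 0`. -/
def cLower (A : H →L[ℂ] H) : ℝ≥0∞ := (limUnder atTop (upperSlope A))⁻¹

/-- The upper bound `c̄(A)`, in `[0, ∞]` with `0⁻¹ = ∞` and `∞⁻¹ = 0`. -/
def cUpper (A : H →L[ℂ] H) : ℝ≥0∞ := (limUnder atTop (lowerSlope A))⁻¹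

end SingularTraces

end

/-! ### Growth rates of a nondecreasing function. -/

namespace SingularTraces

/-! Only two properties of a singular trace matter: it is monotone, and it does not see finite rank
perturbations or unitary position. Diagonalise `B = |A| ^ α` along an orthonormal sequence with
eigenvalues `lam m`. Spreading `k` copies of `B` over the residue classes mod `k` of the same
sequence gives an operator with eigenvalues `lam (m / k)` and trace `k * τ B`
(`IsDiagonal.exists_ampliation`). If `c * lam (m / k) ≤ lam m` for all large `m`, then `c` times
this operator is at most `B` plus a multiple of a finite rank projection
(`IsSingularTrace.le_of_eventually_le`), so `τ B = 1` forces `c * k ≤ 1`. The reverse inequality on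
eigenvalues forces `1 ≤ c * k`.

Steps `h = log k` of `f` are dilations by `k` of the index of `μ`. If the upper limit were below `1
/ α`, a slope `c` strictly between would allow the factor `k ^ (-c * α)`, and `k ^ (1 - c * α) ≤ 1`
is false for `k > 1`. The lower limit is treated dually.

The limits exist by a Fekete argument: a bound on all late increments of one length `h` can be
iterated, and monotonicity interpolates between multiples of `h`. The same iteration from a fixed
starting point bounds `f t / t`, hence the order of infinitesimal. -/

/-- The upper growth rate of `f` at step `h`. -/
noncomputable def upperGrowth (f : ℝ → ℝ) (h : ℝ) : ℝ≥0∞ :=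
  limsup (fun t : ℝ => ENNReal.ofReal ((f (t + h) - f t) / h)) atTop

/-- The lower growth rate of `f` at step `h`. -/
noncomputable def lowerGrowth (f : ℝ → ℝ) (h : ℝ) : ℝ≥0∞ :=
  liminf (fun t : ℝ => ENNReal.ofReal ((f (t + h) - f t) / h)) atTop

/-- Iterate the step bound and round `s` up to a multiple of `h`; monotonicity makes the rounding
cost at most `c * h`. The lower analogue rounds down. -/
lemma increment_le_of_step_le {f : ℝ → ℝ} (hf : MonotoneOn f (Set.Ici 0)) {h c t₀ : ℝ}
    (hh : 0 < h) (hc : 0 ≤ c) (ht₀ : 0 ≤ t₀) (H : ∀ t, t₀ ≤ t → f (t + h) - f t ≤ c * h)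
    {t s : ℝ} (ht : t₀ ≤ t) (hs : 0 ≤ s) : f (t + s) - f t ≤ c * (s + h) := by
  have key : ∀ n : ℕ, f (t + n * h) - f t ≤ c * (n * h) := by
    intro n
    induction n with
    | zero => simp
    | succ n ih =>
      have := H (t + n * h) (by nlinarith [mul_nonneg n.cast_nonneg hh.le])
      have e : t + ((n + 1 : ℕ) : ℝ) * h = t + n * h + h := by push_cast; ring
      rw [e]; push_cast; linarith
  have h1 := key (⌊s / h⌋₊ + 1)
  have h2 : s < ((⌊s / h⌋₊ : ℝ) + 1) * h := (div_lt_iff₀ hh).1 (Nat.lt_floor_add_one _)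
  have h3 : (⌊s / h⌋₊ : ℝ) * h ≤ s := (le_div_iff₀ hh).1 (Nat.floor_le (by positivity))
  have h4 : f (t + s) ≤ f (t + ((⌊s / h⌋₊ + 1 : ℕ) : ℝ) * h) := by
    apply hf
    · simp only [Set.mem_Ici]; linarith
    · simp only [Set.mem_Ici]; push_cast; linarith
    · push_cast; linarith
  push_cast at h1 h4
  have h5 : c * ((⌊s / h⌋₊ : ℝ) * h) ≤ c * s := mul_le_mul_of_nonneg_left h3 hc
  linarith

lemma le_increment_of_le_step {f : ℝ → ℝ} (hf : MonotoneOn f (Set.Ici 0)) {h c t₀ : ℝ}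
    (hh : 0 < h) (hc : 0 ≤ c) (ht₀ : 0 ≤ t₀) (H : ∀ t, t₀ ≤ t → c * h ≤ f (t + h) - f t)
    {t s : ℝ} (ht : t₀ ≤ t) (hs : 0 ≤ s) : c * (s - h) ≤ f (t + s) - f t := by
  have key : ∀ n : ℕ, c * (n * h) ≤ f (t + n * h) - f t := by
    intro n
    induction n with
    | zero => simp
    | succ n ih =>
      have := H (t + n * h) (by nlinarith [mul_nonneg n.cast_nonneg hh.le])
      have e : t + ((n + 1 : ℕ) : ℝ) * h = t + n * h + h := by push_cast; ring
      rw [e]; push_cast; linarith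
  have h1 := key ⌊s / h⌋₊
  have h2 : s < ((⌊s / h⌋₊ : ℝ) + 1) * h := (div_lt_iff₀ hh).1 (Nat.lt_floor_add_one _)
  have h3 : (⌊s / h⌋₊ : ℝ) * h ≤ s := (le_div_iff₀ hh).1 (Nat.floor_le (by positivity))
  have h0 : 0 ≤ (⌊s / h⌋₊ : ℝ) * h := by positivity
  have h4 : f (t + (⌊s / h⌋₊ : ℝ) * h) ≤ f (t + s) := by
    apply hf
    · simp only [Set.mem_Ici]; linarith
    · simp only [Set.mem_Ici]; linarith
    · linarith
  have h5 : c * (s - h) ≤ c * ((⌊s / h⌋₊ : ℝ) * h) :=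
    mul_le_mul_of_nonneg_left (by linarith) hc
  linarith

lemma exists_step_le_of_upperGrowth_lt {f : ℝ → ℝ} {h c : ℝ} (hh : 0 < h)
    (H : upperGrowth f h < ENNReal.ofReal c) :
    ∃ t₀, 0 ≤ t₀ ∧ ∀ t, t₀ ≤ t → f (t + h) - f t ≤ c * h := by
  obtain ⟨t₀, ht₀⟩ := eventually_atTop.1 (eventually_lt_of_limsup_lt H)
  refine ⟨max t₀ 0, le_max_right _ _, fun t ht => ?_⟩
  have h1 := (ENNReal.ofReal_lt_ofReal_iff'.1 (ht₀ t ((le_max_left _ _).trans ht))).1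
  exact ((div_lt_iff₀ hh).1 h1).le

lemma exists_le_step_of_lt_lowerGrowth {f : ℝ → ℝ} {h c : ℝ} (hh : 0 < h)
    (H : ENNReal.ofReal c < lowerGrowth f h) :
    ∃ t₀, 0 ≤ t₀ ∧ ∀ t, t₀ ≤ t → c * h ≤ f (t + h) - f t := by
  obtain ⟨t₀, ht₀⟩ := eventually_atTop.1 (eventually_lt_of_lt_liminf H)
  refine ⟨max t₀ 0, le_max_right _ _, fun t ht => ?_⟩
  have h1 := (ENNReal.ofReal_lt_ofReal_iff'.1 (ht₀ t ((le_max_left _ _).trans ht))).1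
  exact ((lt_div_iff₀ hh).1 h1).le

lemma tendsto_linear_div (a b : ℝ) : Tendsto (fun s : ℝ => (a * s + b) / s) atTop (𝓝 a) := by
  have h1 : Tendsto (fun s : ℝ => a + b / s) atTop (𝓝 (a + 0)) :=
    tendsto_const_nhds.add (tendsto_const_nhds.div_atTop tendsto_id)
  rw [add_zero] at h1
  refine h1.congr' ?_
  filter_upwards [eventually_gt_atTop 0] with s hs
  field_simp

lemma limsup_ofReal_div_le {g : ℝ → ℝ} {c b : ℝ} (H : ∀ᶠ s in atTop, g s ≤ c * s + b) :
    limsup (fun s : ℝ => ENNReal.ofReal (g s / s)) atTop ≤ ENNReal.ofReal c := by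
  rw [← ((ENNReal.continuous_ofReal.tendsto c).comp (tendsto_linear_div c b)).limsup_eq]
  refine limsup_le_limsup ?_
  filter_upwards [H, eventually_gt_atTop 0] with s hs h0
  exact ENNReal.ofReal_le_ofReal (div_le_div_of_nonneg_right hs h0.le)

lemma le_liminf_ofReal_div {g : ℝ → ℝ} {c b : ℝ} (H : ∀ᶠ s in atTop, c * s + b ≤ g s) :
    ENNReal.ofReal c ≤ liminf (fun s : ℝ => ENNReal.ofReal (g s / s)) atTop := by
  rw [← ((ENNReal.continuous_ofReal.tendsto c).comp (tendsto_linear_div c b)).liminf_eq]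
  refine liminf_le_liminf ?_
  filter_upwards [H, eventually_gt_atTop 0] with s hs h0
  exact ENNReal.ofReal_le_ofReal (div_le_div_of_nonneg_right hs h0.le)

lemma le_of_forall_ofReal_gt {a b : ℝ≥0∞}
    (H : ∀ c : ℝ, 0 ≤ c → b < ENNReal.ofReal c → a ≤ ENNReal.ofReal c) : a ≤ b := by
  refine le_of_forall_gt_imp_ge_of_dense fun x hx => ?_
  rcases eq_or_ne x ∞ with rfl | hx'
  · exact le_top
  · have := H x.toReal ENNReal.toReal_nonneg
    rw [ENNReal.ofReal_toReal hx'] at this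
    exact this hx

lemma le_of_forall_ofReal_lt {a b : ℝ≥0∞}
    (H : ∀ c : ℝ, 0 ≤ c → ENNReal.ofReal c < a → ENNReal.ofReal c ≤ b) : a ≤ b := by
  refine le_of_forall_lt_imp_le_of_dense fun x hx => ?_
  have := H x.toReal ENNReal.toReal_nonneg
  rw [ENNReal.ofReal_toReal hx.ne_top] at this
  exact this hx

/-- Any `c` above the rate at step `h` gives the bound `c + c * h / s` at step `s`, whose excess
vanishes as `s → ∞`. Since this holds for every `h > 0`, the limsup is also below the liminf. -/
lemma limsup_upperGrowth_le {f : ℝ → ℝ} (hf : MonotoneOn f (Set.Ici 0)) {h : ℝ} (hh : 0 < h) :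
    limsup (upperGrowth f) atTop ≤ upperGrowth f h := by
  refine le_of_forall_ofReal_gt fun c hc H => ?_
  obtain ⟨t₀, ht₀, H'⟩ := exists_step_le_of_upperGrowth_lt hh H
  have h1 : ∀ s, 0 < s → upperGrowth f s ≤ ENNReal.ofReal ((c * s + c * h) / s) := by
    intro s hs
    refine limsup_le_of_le (h := ?_)
    filter_upwards [eventually_ge_atTop t₀] with t ht
    refine ENNReal.ofReal_le_ofReal (div_le_div_of_nonneg_right ?_ hs.le)
    have := increment_le_of_step_le hf hh hc ht₀ H' ht hs.le
    linarith
  rw [← ((ENNReal.continuous_ofReal.tendsto c).comp (tendsto_linear_div c (c * h))).limsup_eq]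
  refine limsup_le_limsup ?_
  filter_upwards [eventually_gt_atTop 0] with s hs using h1 s hs

lemma le_liminf_lowerGrowth {f : ℝ → ℝ} (hf : MonotoneOn f (Set.Ici 0)) {h : ℝ} (hh : 0 < h) :
    lowerGrowth f h ≤ liminf (lowerGrowth f) atTop := by
  refine le_of_forall_ofReal_lt fun c hc H => ?_
  obtain ⟨t₀, ht₀, H'⟩ := exists_le_step_of_lt_lowerGrowth hh H
  have h1 : ∀ s, 0 < s → ENNReal.ofReal ((c * s + -(c * h)) / s) ≤ lowerGrowth f s := by
    intro s hs
    refine le_liminf_of_le (h := ?_)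
    filter_upwards [eventually_ge_atTop t₀] with t ht
    refine ENNReal.ofReal_le_ofReal (div_le_div_of_nonneg_right ?_ hs.le)
    have := le_increment_of_le_step hf hh hc ht₀ H' ht hs.le
    linarith
  rw [← ((ENNReal.continuous_ofReal.tendsto c).comp (tendsto_linear_div c (-(c * h)))).liminf_eq]
  refine liminf_le_liminf ?_
  filter_upwards [eventually_gt_atTop 0] with s hs using h1 s hs

/-- Fekete's lemma for the upper growth rates of a nondecreasing function. -/
lemma tendsto_upperGrowth {f : ℝ → ℝ} (hf : MonotoneOn f (Set.Ici 0)) :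
    Tendsto (upperGrowth f) atTop (𝓝 (limsup (upperGrowth f) atTop)) := by
  refine tendsto_of_le_liminf_of_limsup_le ?_ le_rfl
  refine le_liminf_of_le (h := ?_)
  filter_upwards [eventually_gt_atTop 0] with h hh using limsup_upperGrowth_le hf hh

/-- Fekete's lemma for the lower growth rates of a nondecreasing function. -/
lemma tendsto_lowerGrowth {f : ℝ → ℝ} (hf : MonotoneOn f (Set.Ici 0)) :
    Tendsto (lowerGrowth f) atTop (𝓝 (liminf (lowerGrowth f) atTop)) := by
  refine tendsto_of_le_liminf_of_limsup_le le_rfl ?_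
  refine limsup_le_of_le (h := ?_)
  filter_upwards [eventually_gt_atTop 0] with h hh using le_liminf_lowerGrowth hf hh

/-- Here the starting point `t₀` is fixed and the increment runs to `t`, so `f t₀` and the rounding
error are constants that disappear after division by `t`. -/
lemma limsup_div_self_le_upperGrowth {f : ℝ → ℝ} (hf : MonotoneOn f (Set.Ici 0)) {h : ℝ}
    (hh : 0 < h) :
    limsup (fun t : ℝ => ENNReal.ofReal (f t / t)) atTop ≤ upperGrowth f h := by
  refine le_of_forall_ofReal_gt fun c hc H => ?_
  obtain ⟨t₀, ht₀, H'⟩ := exists_step_le_of_upperGrowth_lt hh H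
  refine limsup_ofReal_div_le (b := f t₀ + c * (h - t₀)) ?_
  filter_upwards [eventually_ge_atTop t₀] with t ht
  have := increment_le_of_step_le hf hh hc ht₀ H' le_rfl (sub_nonneg.2 ht)
  rw [add_sub_cancel] at this
  linarith

lemma lowerGrowth_le_liminf_div_self {f : ℝ → ℝ} (hf : MonotoneOn f (Set.Ici 0)) {h : ℝ}
    (hh : 0 < h) :
    lowerGrowth f h ≤ liminf (fun t : ℝ => ENNReal.ofReal (f t / t)) atTop := by
  refine le_of_forall_ofReal_lt fun c hc H => ?_
  obtain ⟨t₀, ht₀, H'⟩ := exists_le_step_of_lt_lowerGrowth hh H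
  refine le_liminf_ofReal_div (b := f t₀ - c * (h + t₀)) ?_
  filter_upwards [eventually_ge_atTop t₀] with t ht
  have := le_increment_of_le_step hf hh hc ht₀ H' le_rfl (sub_nonneg.2 ht)
  rw [add_sub_cancel] at this
  linarith

end SingularTraces

/-! ### Spectral analysis of the compact operator `|A|`. -/

namespace SingularTraces

section Spectral

variable {H : Type*} [NormedAddCommGroup H] [InnerProductSpace ℂ H] [CompleteSpace H]

lemma norm_abs_apply (A : H →L[ℂ] H) (x : H) : ‖CFC.abs A x‖ = ‖A x‖ := by
  have h1 : CFC.abs A * CFC.abs A = star A * A := CFC.abs_mul_abs A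
  have h2 : star (CFC.abs A) = CFC.abs A := (CFC.abs_nonneg A).isSelfAdjoint.star_eq
  have h3 : inner ℂ (CFC.abs A x) (CFC.abs A x) = inner ℂ (A x) (A x) := by
    rw [← ContinuousLinearMap.adjoint_inner_left, ← ContinuousLinearMap.star_eq_adjoint, h2,
      ← ContinuousLinearMap.adjoint_inner_left A, ← ContinuousLinearMap.star_eq_adjoint,
      ← mul_apply_eq_comp, h1, mul_apply_eq_comp]
  rw [← sq_eq_sq₀ (norm_nonneg _) (norm_nonneg _)]
  rw [inner_self_eq_norm_sq_to_K, inner_self_eq_norm_sq_to_K] at h3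
  exact_mod_cast h3

/-- Since `‖|A| x - |A| y‖ = ‖A x - A y‖`, centres of a finite net for the image of the ball under
`A` also give a net for `|A|`; no polar decomposition is needed. -/
lemma isCompactOperator_abs {A : H →L[ℂ] H} (hA : IsCompactOperator A) :
    IsCompactOperator (CFC.abs A : H →L[ℂ] H) := by
  have hK := (isCompactOperator_iff_isCompact_closure_image_closedBall
    (A : H →ₗ[ℂ] H) one_pos).1 hA
  refine (isCompactOperator_iff_isCompact_closure_image_closedBall
    ((CFC.abs A : H →L[ℂ] H) : H →ₗ[ℂ] H) one_pos).2 ?_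
  have htb : TotallyBounded (A '' Metric.closedBall 0 1) :=
    hK.totallyBounded.subset subset_closure
  have : TotallyBounded ((CFC.abs A : H →L[ℂ] H) '' Metric.closedBall 0 1) := by
    refine Metric.totallyBounded_iff.2 fun ε hε => ?_
    obtain ⟨t, hts, htf, ht⟩ := Metric.finite_approx_of_totallyBounded htb ε hε
    obtain ⟨u, -, huf, hut⟩ := (Set.exists_subset_image_finite_and (p := fun s => s = t)).1
      ⟨t, hts, htf, rfl⟩
    refine ⟨(CFC.abs A : H →L[ℂ] H) '' u, huf.image _, ?_⟩
    rintro _ ⟨x, hx, rfl⟩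
    have := ht ⟨x, hx, rfl⟩
    simp only [← hut, Set.mem_iUnion, Metric.mem_ball, exists_prop] at this ⊢
    obtain ⟨_, ⟨y, hy, rfl⟩, hxy⟩ := this
    refine ⟨_, ⟨y, hy, rfl⟩, ?_⟩
    rwa [dist_eq_norm, ← map_sub, norm_abs_apply, map_sub, ← dist_eq_norm]
  exact this.closure.isCompact_of_isClosed isClosed_closure

lemma not_finiteDimensional_range_abs {A : H →L[ℂ] H}
    (hA : ¬ FiniteDimensional ℂ (LinearMap.range (A : H →ₗ[ℂ] H))) :
    ¬ FiniteDimensional ℂ (LinearMap.range ((CFC.abs A : H →L[ℂ] H) : H →ₗ[ℂ] H)) := by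
  intro h
  apply hA
  have hker : LinearMap.ker ((CFC.abs A : H →L[ℂ] H) : H →ₗ[ℂ] H) = LinearMap.ker (A : H →ₗ[ℂ] H) := by
    ext x
    simp only [LinearMap.mem_ker, ContinuousLinearMap.coe_coe]
    rw [← norm_eq_zero, norm_abs_apply, norm_eq_zero]
  have e := ((CFC.abs A : H →L[ℂ] H) : H →ₗ[ℂ] H).quotKerEquivRange.symm.trans
    ((Submodule.quotEquivOfEq _ _ hker).trans (A : H →ₗ[ℂ] H).quotKerEquivRange)
  exact Module.Finite.equiv e

-- Images of distinct orthonormal eigenvectors with eigenvalues above `s` are more than `s` apart,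
-- which excludes a convergent subsequence.
omit [CompleteSpace H] in
lemma finite_setOf_lt_eigenvalue {T : H →L[ℂ] H} (hT : IsCompactOperator T) {ι : Type*}
    {v : ι → H} (hv : Orthonormal ℂ v) {w : ι → ℝ} (hw : ∀ i, T (v i) = (w i : ℂ) • v i)
    {s : ℝ} (hs : 0 < s) : {i | s < w i}.Finite := by
  by_contra hinf
  have hinf : {i | s < w i}.Infinite := hinf
  have g := hinf.natEmbedding
  have hK := (isCompactOperator_iff_isCompact_closure_image_closedBall
    (T : H →ₗ[ℂ] H) one_pos).1 hT
  have hmem : ∀ n, T (v (g n)) ∈ closure ((T : H →ₗ[ℂ] H) '' Metric.closedBall 0 1) := fun n =>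
    subset_closure ⟨v (g n), by simp [hv.1], rfl⟩
  obtain ⟨a, -, φ, hφ, hlim⟩ := hK.tendsto_subseq hmem
  obtain ⟨N, hN⟩ := Metric.cauchySeq_iff.1 hlim.cauchySeq s hs
  have h1 := hN N le_rfl (N + 1) (Nat.le_succ N)
  have hne : (g (φ N) : ι) ≠ g (φ (N + 1)) := fun h =>
    (hφ (Nat.lt_succ_self N)).ne (g.injective (Subtype.ext h))
  have hgN : s < w (g (φ N)) := (g (φ N)).2
  have h2 : inner ℂ (v (g (φ N))) (T (v (g (φ N))) - T (v (g (φ (N + 1)))))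
      = (w (g (φ N)) : ℂ) := by
    rw [hw, hw, inner_sub_right, inner_smul_right, inner_smul_right, hv.2 hne,
      inner_self_eq_norm_sq_to_K, hv.1]
    simp
  have h3 := norm_inner_le_norm (𝕜 := ℂ) (v (g (φ N))) (T (v (g (φ N))) - T (v (g (φ (N + 1)))))
  rw [h2, hv.1, one_mul, Complex.norm_real, Real.norm_eq_abs, ← dist_eq_norm] at h3
  simp only [Function.comp_apply] at h1
  linarith [le_abs_self (w (g (φ N)))]

/-- A positive function with finite superlevel sets on an infinite type can be enumerated in
nonincreasing order. -/
lemma exists_equiv_nat_antitone {ι : Type*} [Infinite ι] (w : ι → ℝ) (hpos : ∀ i, 0 < w i)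
    (hfin : ∀ s, 0 < s → {i | s < w i}.Finite) : ∃ φ : ℕ ≃ ι, Antitone (w ∘ φ) := by
  classical
  let _ : LinearOrder ι := linearOrderOfSTO WellOrderingRel
  -- Ties are broken by a well-ordering. Counting predecessors for this key embeds `ι` in `ℕ`, and
  -- the infinite image is then renumbered increasingly.
  let key : ι → ℝᵒᵈ ×ₗ ι := fun i => toLex (OrderDual.toDual (w i), i)
  have hkey : Function.Injective key := fun i j h => congrArg (fun p => (ofLex p).2) h
  have hw : ∀ i j, key i ≤ key j → w j ≤ w i := by
    intro i j h
    rcases (Prod.Lex.toLex_le_toLex).1 h with h | h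
    · exact (OrderDual.toDual_lt_toDual.1 h).le
    · exact (OrderDual.toDual.injective h.1).ge
  have hf : ∀ i, {j | key j < key i}.Finite := fun i =>
    (hfin (w i / 2) (half_pos (hpos i))).subset fun j hj =>
      (half_lt_self (hpos i)).trans_le (hw j i (le_of_lt hj))
  let r : ι → ℕ := fun i => {j | key j < key i}.ncard
  have hr : ∀ i j, key i < key j → r i < r j := fun i j hij =>
    Set.ncard_lt_ncard (Set.ssubset_iff_of_subset (fun k hk => lt_trans hk hij) |>.2
      ⟨i, hij, lt_irrefl (key i)⟩) (hf j)
  have hri : Function.Injective r := by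
    intro i j hij
    rcases lt_trichotomy (key i) (key j) with h | h | h
    · exact absurd hij (hr _ _ h).ne
    · exact hkey h
    · exact absurd hij (hr _ _ h).ne'
  have : Infinite (Set.range r) := (Set.infinite_range_of_injective hri).to_subtype
  let ψ := Nat.Subtype.orderIsoOfNat (Set.range r)
  let ρ := Equiv.ofInjective r hri
  refine ⟨ψ.toEquiv.trans ρ.symm, fun m n hmn => hw _ _ ?_⟩
  by_contra hlt
  have h1 := hr _ _ (not_le.1 hlt)
  have h2 : ∀ n, r (ρ.symm (ψ n)) = ψ n := fun n =>
    congrArg Subtype.val (ρ.apply_symm_apply (ψ n))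
  have h3 : (ψ m : ℕ) ≤ ψ n := ψ.monotone hmn
  simp only [Equiv.trans_apply, RelIso.coe_fn_toEquiv, h2] at h1
  omega

open Module.End in
/-- Eigenvectors for the positive eigenvalues of a compact positive operator of infinite rank,
in nonincreasing order. -/
lemma exists_orthonormal_eigenvectors {T : H →L[ℂ] H} (hT : IsCompactOperator T) (hT0 : 0 ≤ T)
    (hrank : ¬ FiniteDimensional ℂ (LinearMap.range (T : H →ₗ[ℂ] H))) :
    ∃ (e : ℕ → H) (lam : ℕ → ℝ), Orthonormal ℂ e ∧ Antitone lam ∧ (∀ n, 0 < lam n) ∧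
      (∀ n, T (e n) = (lam n : ℂ) • e n) ∧ (∀ x, (∀ n, inner ℂ (e n) x = 0) → T x = 0) ∧
      ∀ l : ℝ, 0 < l → eigenspace (T : H →ₗ[ℂ] H) (l : ℂ) ≤
        Submodule.span ℂ (e '' {n | lam n = l}) := by
  have hpos := (ContinuousLinearMap.nonneg_iff_isPositive T).1 hT0
  have hsym : (T : H →ₗ[ℂ] H).IsSymmetric := hpos.isSymmetric
  have hfd : ∀ l : {l : ℝ // 0 < l},
      FiniteDimensional ℂ (eigenspace (T : H →ₗ[ℂ] H) ((l : ℝ) : ℂ)) := fun l =>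
    ContinuousLinearMap.finite_dimensional_eigenspace hT _ (by exact_mod_cast l.2.ne')
  let b := fun l : {l : ℝ // 0 < l} =>
    stdOrthonormalBasis ℂ (eigenspace (T : H →ₗ[ℂ] H) ((l : ℝ) : ℂ))
  let ι := Σ l : {l : ℝ // 0 < l},
    Fin (Module.finrank ℂ (eigenspace (T : H →ₗ[ℂ] H) ((l : ℝ) : ℂ)))
  let v : ι → H := fun i => b i.1 i.2
  let w : ι → ℝ := fun i => i.1
  have hv : Orthonormal ℂ v := by
    have h1 := hsym.orthogonalFamily_eigenspaces.comp
      (f := fun l : {l : ℝ // 0 < l} => ((l : ℝ) : ℂ))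
      (Complex.ofReal_injective.comp Subtype.coe_injective)
    exact h1.orthonormal_sigma_orthonormal (v_family := fun l => b l) fun l => (b l).orthonormal
  have hw : ∀ i, T (v i) = (w i : ℂ) • v i := fun i => mem_eigenspace_iff.1 (b i.1 i.2).2
  have hspan : ∀ l : ℝ, 0 < l → eigenspace (T : H →ₗ[ℂ] H) (l : ℂ) ≤
      Submodule.span ℂ (v '' {i | w i = l}) := by
    intro l hl x hx
    have h1 := (b ⟨l, hl⟩).sum_repr ⟨x, hx⟩
    have h2 := congrArg Subtype.val h1
    rw [← show _ = x from h2, AddSubmonoidClass.coe_finsetSum]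
    refine Submodule.sum_mem _ fun i _ => Submodule.smul_mem _ _ (Submodule.subset_span ?_)
    exact ⟨⟨⟨l, hl⟩, i⟩, rfl, rfl⟩
  -- If `x` is orthogonal to all positive eigenspaces, then `T x` is orthogonal to every eigenspace,
  -- and these are total by the spectral theorem.
  have hzero : ∀ x, (∀ i, inner ℂ (v i) x = 0) → T x = 0 := by
    intro x hx
    have hperp : ∀ l : ℝ, 0 < l → ∀ y ∈ eigenspace (T : H →ₗ[ℂ] H) (l : ℂ), inner ℂ y x = 0 := by
      intro l hl y hy
      have h1 : Submodule.span ℂ (v '' {i | w i = l}) ≤ (Submodule.span ℂ {x})ᗮ := by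
        rw [Submodule.span_le]
        rintro _ ⟨i, -, rfl⟩
        rw [SetLike.mem_coe, Submodule.mem_orthogonal_singleton_iff_inner_left]
        exact hx i
      exact Submodule.mem_orthogonal_singleton_iff_inner_left.1 (h1 (hspan l hl hy))
    have hbot := ContinuousLinearMap.orthogonalComplement_iSup_eigenspaces_eq_bot hT hsym
    rw [← Submodule.mem_bot ℂ, ← hbot, ← Submodule.iInf_orthogonal, Submodule.mem_iInf]
    intro μ
    rw [Submodule.mem_orthogonal]
    intro y hy
    have hTy : T y = μ • y := mem_eigenspace_iff.1 hy
    have h2 : inner ℂ y (T x) = inner ℂ (T y) x := (hsym y x).symm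
    rw [h2, hTy, inner_smul_left]
    by_cases hy0 : y = 0
    · simp [hy0]
    by_cases hμ : μ = 0
    · simp [hμ]
    have hev : HasEigenvalue (T : H →ₗ[ℂ] H) μ := hasEigenvalue_of_hasEigenvector ⟨hy, hy0⟩
    have hre : (μ.re : ℂ) = μ := Complex.conj_eq_iff_re.1 (hsym.conj_eigenvalue_eq_self hev)
    have hnn : 0 ≤ μ.re := by
      apply eigenvalue_nonneg_of_nonneg (𝕜 := ℂ) (T := (T : H →ₗ[ℂ] H)) (μ := μ.re)
      · rw [← hre] at hev; exact hev
      · exact hpos.re_inner_nonneg_right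
    have hp : 0 < μ.re := hnn.lt_of_ne fun h => hμ (by rw [← hre, ← h]; simp)
    rw [hperp μ.re hp y (by rw [hre]; exact hy), mul_zero]
  -- With finitely many eigenvectors, `T x = T (P x)` for the projection `P` onto their span, so `T`
  -- would have finite rank.
  have : Infinite ι := by
    by_contra hfin
    rw [not_infinite_iff_finite] at hfin
    apply hrank
    have hU : FiniteDimensional ℂ (Submodule.span ℂ (Set.range v)) :=
      FiniteDimensional.span_of_finite ℂ (Set.finite_range v)
    refine Submodule.finiteDimensional_of_le
      (S₂ := (Submodule.span ℂ (Set.range v)).map (T : H →ₗ[ℂ] H)) ?_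
    rintro _ ⟨x, rfl⟩
    refine ⟨(Submodule.span ℂ (Set.range v)).starProjection x,
      Submodule.starProjection_apply_mem _ x, ?_⟩
    have h1 := hzero (x - (Submodule.span ℂ (Set.range v)).starProjection x) fun i =>
      Submodule.mem_orthogonal _ _ |>.1 (Submodule.sub_starProjection_mem_orthogonal x) _
        (Submodule.subset_span ⟨i, rfl⟩)
    rw [map_sub, sub_eq_zero] at h1
    exact h1.symm
  obtain ⟨φ, hφ⟩ := exists_equiv_nat_antitone w (fun i => i.1.2)
    fun s hs => finite_setOf_lt_eigenvalue hT hv hw hs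
  refine ⟨v ∘ φ, w ∘ φ, hv.comp _ φ.injective, hφ, fun n => (φ n).1.2, fun n => hw (φ n),
    fun x hx => hzero x fun i => ?_, fun l hl => (hspan l hl).trans ?_⟩
  · have := hx (φ.symm i)
    rwa [Function.comp_apply, φ.apply_symm_apply] at this
  · refine Submodule.span_mono ?_
    rintro _ ⟨i, hi, rfl⟩
    exact ⟨φ.symm i, by simpa using hi, by simp⟩

open Module.End in
omit [CompleteSpace H] in
lemma eigenvalueCount_eq {T : H →L[ℂ] H} {e : ℕ → H} {lam : ℕ → ℝ} (he : Orthonormal ℂ e)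
    (hT : ∀ n, T (e n) = (lam n : ℂ) • e n)
    (hspan : ∀ l : ℝ, 0 < l → eigenspace (T : H →ₗ[ℂ] H) (l : ℂ) ≤
        Submodule.span ℂ (e '' {n | lam n = l})) {s : ℝ} (hs : 0 ≤ s) :
    eigenvalueCount T s = Cardinal.lift (Cardinal.mk {n | s < lam n}) := by
  have h1 : (⨆ l : {l : ℝ // s < l}, eigenspace (T : H →ₗ[ℂ] H) ((l : ℝ) : ℂ)) =
      Submodule.span ℂ (Set.range fun n : {n | s < lam n} => e n) := by
    apply le_antisymm
    · refine iSup_le fun l => (hspan l (hs.trans_lt l.2)).trans (Submodule.span_mono ?_)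
      rintro _ ⟨n, hn, rfl⟩
      exact ⟨⟨n, by simpa [show lam n = l from hn] using l.2⟩, rfl⟩
    · rw [Submodule.span_le]
      rintro _ ⟨n, rfl⟩
      exact Submodule.mem_iSup_of_mem (⟨lam n, n.2⟩ : {l : ℝ // s < l})
        (mem_eigenspace_iff.2 (hT n))
  have h2 : LinearIndependent ℂ (fun n : {n | s < lam n} => e n) :=
    he.linearIndependent.comp _ Subtype.coe_injective
  have h3 := Cardinal.mk_range_eq_of_injective h2.injective
  rw [eigenvalueCount, h1, rank_span h2]
  simpa using h3

/-- For `s ≥ 0`, at most `n` terms exceed `s` exactly when `lam n ≤ s`, because the sequence is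
nonincreasing. The shift to `n + 1` reconciles indexing from 0 with `μ` indexed from 1. -/
lemma sInf_count_eq {lam : ℕ → ℝ} (hlam : Antitone lam) (hpos : ∀ n, 0 < lam n) (n : ℕ)
    {N : ℝ → Cardinal} (hN : ∀ s, 0 ≤ s → N s = Cardinal.lift (Cardinal.mk {n | s < lam n})) :
    sInf {s : ℝ | 0 ≤ s ∧ N s < ((n + 1 : ℕ) : Cardinal)} = lam n := by
  have : {s : ℝ | 0 ≤ s ∧ N s < ((n + 1 : ℕ) : Cardinal)} = Set.Ici (lam n) := by
    ext s
    simp only [Set.mem_ofPred_eq, Set.mem_Ici]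
    constructor
    · rintro ⟨hs, h⟩
      by_contra! hlt
      rw [hN s hs] at h
      refine absurd h (not_lt.2 ?_)
      have h1 : Set.Iio (n + 1) ⊆ {n | s < lam n} := fun m hm =>
        hlt.trans_le (hlam (Nat.lt_succ_iff.1 hm))
      have h2 := Cardinal.mk_le_mk_of_subset h1
      have h3 : Cardinal.mk (Set.Iio (n + 1)) = ((n + 1 : ℕ) : Cardinal) := by simp
      rw [h3] at h2
      rwa [← Cardinal.lift_le, Cardinal.lift_natCast] at h2
    · intro h
      have hs : 0 ≤ s := (hpos n).le.trans h
      refine ⟨hs, ?_⟩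
      rw [hN s hs]
      have h1 : {n | s < lam n} ⊆ Set.Iio n := fun m hm => by
        by_contra hnm
        exact absurd (hlam (not_lt.1 hnm)) (not_le.2 (h.trans_lt hm))
      have h2 := Cardinal.mk_le_mk_of_subset h1
      have h3 : Cardinal.mk (Set.Iio n) = (n : Cardinal) := by simp
      rw [h3, ← Cardinal.lift_le, Cardinal.lift_natCast] at h2
      exact h2.trans_lt (by exact_mod_cast Nat.lt_succ_self n)
  rw [this, csInf_Ici]

/-- A continuous function of an operator acts on an eigenvector by the value at the eigenvalue. -/
lemma cfc_apply_eigenvector {T : H →L[ℂ] H} (hT : IsSelfAdjoint T) {f : ℝ → ℝ}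
    (hf : ContinuousOn f (spectrum ℝ T)) {l : ℝ} {x : H} (hx : T x = (l : ℂ) • x) :
    cfc f T x = (f l : ℂ) • x := by
  rcases eq_or_ne x 0 with rfl | hx0
  · simp
  have hl : l ∈ spectrum ℝ T := by
    intro hu
    apply hx0
    obtain ⟨u, hu⟩ := hu
    have h1 : (u : H →L[ℂ] H) x = 0 := by
      rw [hu, sub_apply, hx, sub_eq_zero,
        Algebra.algebraMap_eq_smul_one]
      simp
    have h2 : ((↑u⁻¹ : H →L[ℂ] H) * u) x = x := by rw [u.inv_mul]; rfl
    rw [← h2, mul_apply_eq_comp, h1, map_zero]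
  have : CompactSpace (spectrum ℝ T) := isCompact_iff_compactSpace.1 (spectrum.isCompact T)
  rw [cfc_apply f T hT hf]
  suffices H : ∀ g : C(spectrum ℝ T, ℝ), cfcHom hT g x = (g ⟨l, hl⟩ : ℂ) • x by
    rw [H]; rfl
  intro g
  -- The functions `g` for which the claim holds form a closed star-subalgebra containing the
  -- identity function, so Stone–Weierstrass applies.
  induction g using ContinuousMap.induction_on_of_compact with
  | const r =>
    have : ContinuousMap.const (spectrum ℝ T) r = algebraMap ℝ C(spectrum ℝ T, ℝ) r := rfl
    rw [this, AlgHomClass.commutes, Algebra.algebraMap_eq_smul_one]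
    simp
  | id =>
    have := cfcHom_id (R := ℝ) hT
    rw [show ContinuousMap.restrict (spectrum ℝ T) (ContinuousMap.id ℝ) = _ from rfl, this, hx]
    rfl
  | star_id =>
    have := cfcHom_id (R := ℝ) hT
    rw [map_star, this, hT.star_eq, hx]
    rfl
  | add f g hf hg =>
    rw [map_add, add_apply, hf, hg]
    simp [add_smul]
  | mul f g hf hg =>
    rw [map_mul, mul_apply_eq_comp, hg, map_smul, hf, smul_smul]
    simp [mul_comm]
  | frequently f hf =>
    have hcl : IsClosed {g : C(spectrum ℝ T, ℝ) | cfcHom hT g x = (g ⟨l, hl⟩ : ℂ) • x} := by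
      refine isClosed_eq ?_ ?_
      · exact (ContinuousLinearMap.apply ℂ H x).continuous.comp (cfcHom_continuous hT)
      · fun_prop
    exact hcl.mem_of_frequently_of_tendsto hf tendsto_id

lemma rpow_apply_eigenvector {T : H →L[ℂ] H} (hT : 0 ≤ T) {α : ℝ} (hα : 0 < α) {l : ℝ} {x : H} (hx : T x = (l : ℂ) • x) :
    CFC.rpow T α x = ((l ^ α : ℝ) : ℂ) • x := by
  have h1 : CFC.rpow T α = cfc (fun x : ℝ => x ^ α) T := CFC.rpow_eq_cfc_real hT
  rw [h1]
  refine cfc_apply_eigenvector hT.isSelfAdjoint (f := fun x : ℝ => x ^ α) ?_ hx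
  exact (Real.continuous_rpow_const hα.le).continuousOn

end Spectral

end SingularTraces

/-! ### Traces of diagonal operators and their ampliations. -/

namespace SingularTraces

section Trace

open ContinuousLinearMap

variable {H : Type*} [NormedAddCommGroup H] [InnerProductSpace ℂ H] [CompleteSpace H]
  {K : Type*} [NormedAddCommGroup K] [InnerProductSpace ℂ K] [CompleteSpace K]

lemma le_of_re_inner_le {S T : H →L[ℂ] H} (hS : IsSelfAdjoint S) (hT : IsSelfAdjoint T)
    (h : ∀ x, (inner ℂ (S x) x).re ≤ (inner ℂ (T x) x).re) : S ≤ T := by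
  rw [ContinuousLinearMap.le_def, isPositive_def']
  refine ⟨hT.sub hS, fun x => ?_⟩
  simpa [reApplyInnerSelf, inner_sub_left] using h x

lemma IsTracialWeight.mono {τ : (H →L[ℂ] H) → ℝ≥0∞} (hτ : IsTracialWeight τ)
    {S T : H →L[ℂ] H} (hS : 0 ≤ S) (hST : S ≤ T) : τ S ≤ τ T := by
  have := hτ.map_add S (T - S) hS (sub_nonneg.2 hST)
  rw [add_sub_cancel] at this
  rw [this]
  exact le_self_add

lemma IsTracialWeight.map_zero {τ : (H →L[ℂ] H) → ℝ≥0∞} (hτ : IsTracialWeight τ) : τ 0 = 0 := by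
  simpa using hτ.map_smul 0 0 le_rfl

lemma IsTracialWeight.map_sum {τ : (H →L[ℂ] H) → ℝ≥0∞} (hτ : IsTracialWeight τ) {ι : Type*}
    (s : Finset ι) {S : ι → H →L[ℂ] H} (hS : ∀ i, 0 ≤ S i) :
    τ (∑ i ∈ s, S i) = ∑ i ∈ s, τ (S i) := by
  classical
  induction s using Finset.induction_on with
  | empty => simpa using hτ.map_zero
  | insert i s hi ih =>
    rw [Finset.sum_insert hi, Finset.sum_insert hi,
      hτ.map_add _ _ (hS i) (Finset.sum_nonneg fun j _ => hS j), ih]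

lemma adjoint_linearIsometry_apply (U : K →ₗᵢ[ℂ] H) (y : K) :
    adjoint U.toContinuousLinearMap (U y) = y :=
  congrArg (fun f : K →L[ℂ] K => f y)
    ((norm_map_iff_adjoint_comp_self U.toContinuousLinearMap).1 U.norm_map)

/-- Write `C = Y * Y` with `Y` self-adjoint and take `X = V Y W*`: then `X X* = V C V*` and `X* X =
W C W*`. -/
lemma IsTracialWeight.conj_linearIsometry_eq {τ : (H →L[ℂ] H) → ℝ≥0∞} (hτ : IsTracialWeight τ)
    (V W : K →ₗᵢ[ℂ] H) {C : K →L[ℂ] K} (hC : 0 ≤ C) :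
    τ (V.toContinuousLinearMap ∘L C ∘L adjoint V.toContinuousLinearMap) =
      τ (W.toContinuousLinearMap ∘L C ∘L adjoint W.toContinuousLinearMap) := by
  obtain ⟨Y, hY, rfl⟩ := CStarAlgebra.nonneg_iff_exists_isSelfAdjoint_and_eq_mul_self.1 hC
  have hY' : adjoint Y = Y := hY
  have h2 := hτ.map_star_mul_self
    (V.toContinuousLinearMap ∘L Y ∘L adjoint W.toContinuousLinearMap)
  rw [star_eq_adjoint, adjoint_comp, adjoint_comp, adjoint_adjoint, hY'] at h2
  convert! h2.symm using 2
  · ext x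
    simp [adjoint_linearIsometry_apply]
  · ext x
    simp [adjoint_linearIsometry_apply]

/-- The isometry from `ℓ²` with a given orthonormal sequence as images of the unit vectors. -/
noncomputable def seqIsometry {e : ℕ → H} (he : Orthonormal ℂ e) :
    lp (fun _ : ℕ => ℂ) 2 →ₗᵢ[ℂ] H :=
  he.orthogonalFamily.linearIsometry

lemma seqIsometry_single {e : ℕ → H} (he : Orthonormal ℂ e) (n : ℕ) :
    seqIsometry he (lp.single 2 n (1 : ℂ)) = e n := by
  rw [seqIsometry, OrthogonalFamily.linearIsometry_apply_single]
  simp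

lemma adjoint_seqIsometry_apply {e : ℕ → H} (he : Orthonormal ℂ e) (x : H) (n : ℕ) :
    adjoint (seqIsometry he).toContinuousLinearMap x n = inner ℂ (e n) x := by
  have h1 := lp.inner_single_left (𝕜 := ℂ) (G := fun _ : ℕ => ℂ) n (1 : ℂ)
    (adjoint (seqIsometry he).toContinuousLinearMap x)
  rw [adjoint_inner_right] at h1
  have h2 : (seqIsometry he).toContinuousLinearMap (lp.single 2 n (1 : ℂ)) = e n :=
    seqIsometry_single he n
  rw [h2] at h1
  simpa using h1.symm

/-- An operator which is diagonal with respect to an orthonormal sequence and vanishes on the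
orthogonal complement of the sequence. -/
structure IsDiagonal (B : H →L[ℂ] H) (e : ℕ → H) (lam : ℕ → ℝ) : Prop where
  nonneg : 0 ≤ B
  orthonormal : Orthonormal ℂ e
  apply_eq : ∀ n, B (e n) = (lam n : ℂ) • e n
  apply_eq_zero : ∀ x, (∀ n, inner ℂ (e n) x = 0) → B x = 0

namespace IsDiagonal

variable {B : H →L[ℂ] H} {e : ℕ → H} {lam : ℕ → ℝ}

/-- The compression of a diagonal operator to `ℓ²`. -/
noncomputable def compression (hB : IsDiagonal B e lam) :
    lp (fun _ : ℕ => ℂ) 2 →L[ℂ] lp (fun _ : ℕ => ℂ) 2 :=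
  adjoint (seqIsometry hB.orthonormal).toContinuousLinearMap ∘L B ∘L
    (seqIsometry hB.orthonormal).toContinuousLinearMap

lemma compression_nonneg (hB : IsDiagonal B e lam) : 0 ≤ hB.compression := by
  rw [nonneg_iff_isPositive]
  exact ((nonneg_iff_isPositive B).1 hB.nonneg).adjoint_conj _

lemma compression_apply (hB : IsDiagonal B e lam) (y : lp (fun _ : ℕ => ℂ) 2) (n : ℕ) :
    hB.compression y n = lam n * y n := by
  have hsym : (B : H →ₗ[ℂ] H).IsSymmetric := ((nonneg_iff_isPositive B).1 hB.nonneg).isSymmetric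
  rw [compression, comp_apply, comp_apply, adjoint_seqIsometry_apply]
  have h1 := hsym (e n) ((seqIsometry hB.orthonormal).toContinuousLinearMap y)
  simp only [ContinuousLinearMap.coe_coe] at h1
  rw [← h1, hB.apply_eq, inner_smul_left, ← adjoint_seqIsometry_apply hB.orthonormal,
    LinearIsometry.coe_toContinuousLinearMap,
    adjoint_linearIsometry_apply, Complex.conj_ofReal]

lemma eq_conj_compression (hB : IsDiagonal B e lam) :
    (seqIsometry hB.orthonormal).toContinuousLinearMap ∘L hB.compression ∘L
      adjoint (seqIsometry hB.orthonormal).toContinuousLinearMap = B := by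
  set W := (seqIsometry hB.orthonormal).toContinuousLinearMap with hW
  have h1 : B ∘L (W ∘L adjoint W) = B := by
    ext x
    have := hB.apply_eq_zero (x - W (adjoint W x)) fun n => by
      rw [← adjoint_seqIsometry_apply hB.orthonormal, _root_.map_sub, hW,
        LinearIsometry.coe_toContinuousLinearMap, adjoint_linearIsometry_apply, sub_self]
      rfl
    rw [_root_.map_sub, sub_eq_zero] at this
    exact this.symm
  have hBa : adjoint B = B := hB.nonneg.isSelfAdjoint
  have h2 : (W ∘L adjoint W) ∘L B = B := by
    have := congrArg adjoint h1
    rwa [adjoint_comp, adjoint_comp, adjoint_adjoint, hBa] at this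
  calc W ∘L hB.compression ∘L adjoint W = (W ∘L adjoint W) ∘L (B ∘L (W ∘L adjoint W)) := rfl
    _ = B := by rw [h1, h2]

/-- The compression multiplies coordinates by `lam`, so this is the inner product of `ℓ²` written
out. Allowing another sequence `e'` serves to place copies of `B` elsewhere. -/
lemma hasSum_re_inner_conj (hB : IsDiagonal B e lam) {e' : ℕ → H} (he' : Orthonormal ℂ e')
    (x : H) :
    HasSum (fun n => lam n * ‖inner ℂ (e' n) x‖ ^ 2)
      (inner ℂ (((seqIsometry he').toContinuousLinearMap ∘L hB.compression ∘L
        adjoint (seqIsometry he').toContinuousLinearMap) x) x).re := by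
  rw [comp_apply, comp_apply, ← adjoint_inner_right]
  have h1 := lp.hasSum_inner (𝕜 := ℂ)
    (hB.compression (adjoint (seqIsometry he').toContinuousLinearMap x))
    (adjoint (seqIsometry he').toContinuousLinearMap x)
  convert! Complex.hasSum_re h1 using 1
  ext n
  rw [compression_apply, adjoint_seqIsometry_apply, ← smul_eq_mul (lam n : ℂ), inner_smul_left,
    Complex.conj_ofReal, inner_self_eq_norm_sq_to_K, Complex.re_ofReal_mul]
  norm_cast

lemma hasSum_re_inner (hB : IsDiagonal B e lam) (x : H) :
    HasSum (fun n => lam n * ‖inner ℂ (e n) x‖ ^ 2) (inner ℂ (B x) x).re := by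
  have := hB.hasSum_re_inner_conj hB.orthonormal x
  rwa [hB.eq_conj_compression] at this

/-- The `k`-fold ampliation of a diagonal operator. -/
lemma exists_ampliation (hB : IsDiagonal B e lam) {k : ℕ} (hk : 0 < k) :
    ∃ E : H →L[ℂ] H, 0 ≤ E ∧ (∀ τ : (H →L[ℂ] H) → ℝ≥0∞, IsTracialWeight τ → τ E = k * τ B) ∧
      ∀ x, HasSum (fun m => lam (m / k) * ‖inner ℂ (e m) x‖ ^ 2) (inner ℂ (E x) x).re := by
  have hinj : ∀ j, Function.Injective fun n => k * n + j := fun j a b h => by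
    simpa [hk.ne'] using h
  have he : ∀ j, Orthonormal ℂ (fun n => e (k * n + j)) := fun j =>
    hB.orthonormal.comp _ (hinj j)
  -- `E j` is the copy of `B` carried by the vectors `e (k * n + j)`; in the sum, `e m` thus
  -- receives the eigenvalue `lam (m / k)`.
  let E : ℕ → H →L[ℂ] H := fun j => (seqIsometry (he j)).toContinuousLinearMap ∘L
    hB.compression ∘L adjoint (seqIsometry (he j)).toContinuousLinearMap
  have hE : ∀ j, 0 ≤ E j := fun j => by
    rw [nonneg_iff_isPositive]
    exact ((nonneg_iff_isPositive _).1 hB.compression_nonneg).conj_adjoint _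
  refine ⟨∑ j ∈ Finset.range k, E j, Finset.sum_nonneg fun j _ => hE j, fun τ hτ => ?_,
    fun x => ?_⟩
  · rw [hτ.map_sum _ hE]
    have h1 : ∀ j ∈ Finset.range k, τ (E j) = τ B := fun j _ => by
      rw [hτ.conj_linearIsometry_eq _ (seqIsometry hB.orthonormal) hB.compression_nonneg,
        hB.eq_conj_compression]
    rw [Finset.sum_congr rfl h1]
    simp
  · have h1 : ∀ j ∈ Finset.range k, HasSum
        (fun m => if m % k = j then lam (m / k) * ‖inner ℂ (e m) x‖ ^ 2 else 0)
        (inner ℂ (E j x) x).re := by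
      intro j hj
      have hjk := Finset.mem_range.1 hj
      rw [← (hinj j).hasSum_iff]
      · convert! hB.hasSum_re_inner_conj (he j) x using 1
        ext n
        simp only [Function.comp_apply]
        rw [if_pos (by rw [Nat.mul_add_mod, Nat.mod_eq_of_lt hjk]), Nat.mul_add_div hk,
          Nat.div_eq_of_lt hjk, add_zero]
      · intro m hm
        rw [if_neg]
        rintro rfl
        exact hm ⟨m / k, Nat.div_add_mod m k⟩
    have h2 := hasSum_sum h1
    rw [_root_.sum_apply, sum_inner, Complex.re_sum]
    convert! h2 using 1
    ext m
    rw [Finset.sum_ite_eq, if_pos (Finset.mem_range.2 (Nat.mod_lt m hk))]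

end IsDiagonal

/-- The finitely many indices where `a m ≤ b m` may fail are absorbed by `M • P`, with `P` the
projection onto the first `N` vectors; `τ P = 0`. -/
lemma IsSingularTrace.le_of_eventually_le {τ : (H →L[ℂ] H) → ℝ≥0∞} (hτ : IsSingularTrace τ)
    {e : ℕ → H} (he : Orthonormal ℂ e) {S T : H →L[ℂ] H} (hS : 0 ≤ S) (hT : 0 ≤ T)
    {a b : ℕ → ℝ} (hb : ∀ n, 0 ≤ b n)
    (hSa : ∀ x, HasSum (fun m => a m * ‖inner ℂ (e m) x‖ ^ 2) (inner ℂ (S x) x).re)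
    (hTb : ∀ x, HasSum (fun m => b m * ‖inner ℂ (e m) x‖ ^ 2) (inner ℂ (T x) x).re)
    {N : ℕ} (hab : ∀ m, N ≤ m → a m ≤ b m) : τ S ≤ τ T := by
  let U : Submodule ℂ H := Submodule.span ℂ (e '' Finset.range N)
  have : FiniteDimensional ℂ U :=
    FiniteDimensional.span_of_finite ℂ ((Finset.range N).finite_toSet.image e)
  let P : H →L[ℂ] H := U.starProjection
  have hP : IsStarProjection P := isStarProjection_starProjection
  have hP0 : 0 ≤ P := (nonneg_iff_isPositive P).2 (IsPositive.of_isStarProjection hP)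
  have hτP : τ P = 0 := by
    refine hτ.map_finiteRank P hP ?_
    have : LinearMap.range (P : H →ₗ[ℂ] H) = U := U.range_starProjection
    rw [this]
    infer_instance
  let M : ℝ≥0 := ∑ m ∈ Finset.range N, (a m).toNNReal
  have hM : ∀ m < N, a m ≤ M := fun m hm =>
    Real.toNNReal_le_iff_le_coe.1 (Finset.single_le_sum (f := fun m => (a m).toNNReal)
      (fun _ _ => zero_le) (Finset.mem_range.2 hm))
  have hMP : 0 ≤ (M : ℂ) • P := by
    rw [nonneg_iff_isPositive]
    exact ((nonneg_iff_isPositive P).1 hP0).smul_of_nonneg (by simp)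
  have hform : ∀ x, ∑ m ∈ Finset.range N, ‖inner ℂ (e m) x‖ ^ 2 ≤ (inner ℂ (P x) x).re := by
    intro x
    have h1 : (inner ℂ (P x) x).re = ‖P x‖ ^ 2 := U.re_inner_starProjection_eq_normSq x
    rw [h1]
    refine le_trans (Finset.sum_le_sum fun m hm => ?_)
      (he.sum_inner_products_le (P x) (s := Finset.range N))
    have h2 : P (e m) = e m :=
      Submodule.starProjection_eq_self_iff.2 (Submodule.subset_span ⟨m, hm, rfl⟩)
    have h3 : inner ℂ (e m) x = inner ℂ (e m) (P x) := by
      have := U.inner_starProjection_left_eq_right (e m) x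
      rw [← this]
      exact congrArg (inner ℂ · x) h2.symm
    rw [h3]
  have hle : S ≤ T + (M : ℂ) • P := by
    refine le_of_re_inner_le hS.isSelfAdjoint (hT.isSelfAdjoint.add hMP.isSelfAdjoint) fun x => ?_
    let g : ℕ → ℝ := fun m => if m < N then (M : ℝ) * ‖inner ℂ (e m) x‖ ^ 2 else 0
    have h1 : HasSum g (∑ m ∈ Finset.range N, g m) := hasSum_sum_of_ne_finset_zero
      fun m hm => if_neg fun h => hm (Finset.mem_range.2 h)
    have h2 := hasSum_le (fun m => ?_) (hSa x) ((hTb x).add h1)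
    · refine h2.trans ?_
      rw [add_apply, inner_add_left, Complex.add_re]
      gcongr
      rw [smul_apply, inner_smul_left, Complex.conj_ofReal, Complex.re_ofReal_mul]
      rw [Finset.sum_congr rfl fun m hm => if_pos (Finset.mem_range.1 hm), ← Finset.mul_sum]
      exact mul_le_mul_of_nonneg_left (hform x) M.2
    · simp only [g]
      have h0 : 0 ≤ ‖inner ℂ (e m) x‖ ^ 2 := by positivity
      split_ifs with h
      · have := mul_le_mul_of_nonneg_right (hM m h) h0
        have := mul_nonneg (hb m) h0
        linarith
      · have := mul_le_mul_of_nonneg_right (hab m (not_lt.1 h)) h0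
        linarith
  calc τ S ≤ τ (T + (M : ℂ) • P) := hτ.mono hS hle
    _ = τ T := by rw [hτ.map_add _ _ hT hMP, hτ.map_smul _ _ hP0, hτP, mul_zero, add_zero]

namespace IsDiagonal

variable {B : H →L[ℂ] H} {e : ℕ → H} {lam : ℕ → ℝ}

omit [CompleteSpace H] in
lemma hasSum_re_inner_smul {E : H →L[ℂ] H} {b : ℕ → ℝ} {x : H}
    (hE : HasSum (fun m => b m * ‖inner ℂ (e m) x‖ ^ 2) (inner ℂ (E x) x).re) (c : ℝ≥0) :
    HasSum (fun m => c * b m * ‖inner ℂ (e m) x‖ ^ 2) (inner ℂ (((c : ℂ) • E) x) x).re := by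
  rw [smul_apply, inner_smul_left, Complex.conj_ofReal, Complex.re_ofReal_mul]
  simpa only [mul_assoc] using hE.mul_left (c : ℝ)

/-- If the diagonal decays slowly along dilations, finite nonzero singular traces are excluded. -/
lemma mul_le_one_of_eventually_le (hB : IsDiagonal B e lam) (hlam : ∀ n, 0 ≤ lam n)
    {τ : (H →L[ℂ] H) → ℝ≥0∞} (hτ : IsSingularTrace τ) (hτB : τ B = 1) {k : ℕ} (hk : 0 < k)
    {c : ℝ≥0} {N : ℕ} (h : ∀ m, N ≤ m → c * lam (m / k) ≤ lam m) : c * k ≤ 1 := by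
  obtain ⟨E, hE0, hEτ, hE⟩ := hB.exists_ampliation hk
  have hcE : 0 ≤ (c : ℂ) • E := by
    rw [nonneg_iff_isPositive]
    exact ((nonneg_iff_isPositive E).1 hE0).smul_of_nonneg (by simp)
  have h1 := hτ.le_of_eventually_le hB.orthonormal hcE hB.nonneg
    hlam
    (fun x => hasSum_re_inner_smul (hE x) c) hB.hasSum_re_inner h
  rw [hτ.map_smul _ _ hE0, hEτ τ hτ.toIsTracialWeight, hτB, mul_one] at h1
  exact_mod_cast h1

/-- If the diagonal decays fast along dilations, finite nonzero singular traces are excluded. -/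
lemma one_le_mul_of_eventually_le (hB : IsDiagonal B e lam) (hlam : ∀ n, 0 ≤ lam n)
    {τ : (H →L[ℂ] H) → ℝ≥0∞} (hτ : IsSingularTrace τ) (hτB : τ B = 1) {k : ℕ} (hk : 0 < k)
    {c : ℝ≥0} {N : ℕ} (h : ∀ m, N ≤ m → lam m ≤ c * lam (m / k)) : 1 ≤ c * k := by
  obtain ⟨E, hE0, hEτ, hE⟩ := hB.exists_ampliation hk
  have hcE : 0 ≤ (c : ℂ) • E := by
    rw [nonneg_iff_isPositive]
    exact ((nonneg_iff_isPositive E).1 hE0).smul_of_nonneg (by simp)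
  have h1 := hτ.le_of_eventually_le hB.orthonormal hB.nonneg hcE
    (fun n => mul_nonneg c.2 (hlam (n / k))) hB.hasSum_re_inner
    (fun x => hasSum_re_inner_smul (hE x) c) h
  rw [hτ.map_smul _ _ hE0, hEτ τ hτ.toIsTracialWeight, hτB, mul_one] at h1
  exact_mod_cast h1

end IsDiagonal

end Trace

end SingularTraces

/-! ### Exponents of singular traceability and the order of infinitesimal. -/

namespace SingularTraces

section Exponents

variable {H : Type*} [NormedAddCommGroup H] [InnerProductSpace ℂ H] [CompleteSpace H]
  {A : H →L[ℂ] H}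

lemma exists_eigenvector_expansion (hA : IsCompactOperator A)
    (hrank : ¬ FiniteDimensional ℂ (LinearMap.range (A : H →ₗ[ℂ] H))) :
    ∃ e : ℕ → H, Antitone (fun n => mu A (n + 1)) ∧ (∀ n, 0 < mu A (n + 1)) ∧
      ∀ α : ℝ, 0 < α → IsDiagonal (CFC.rpow (CFC.abs A) α) e fun n => mu A (n + 1) ^ α := by
  have hT0 : 0 ≤ (CFC.abs A : H →L[ℂ] H) := CFC.abs_nonneg A
  obtain ⟨e, lam, he, hanti, hpos, hT, hzero, hspan⟩ := exists_orthonormal_eigenvectors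
    (isCompactOperator_abs hA) hT0 (not_finiteDimensional_range_abs hrank)
  have hmu : ∀ n, mu A (n + 1) = lam n := fun n =>
    sInf_count_eq hanti hpos n fun s hs => eigenvalueCount_eq he hT hspan hs
  simp only [hmu]
  refine ⟨e, hanti, hpos, fun α hα => ⟨CFC.rpow_nonneg, he, fun n => ?_, fun x hx => ?_⟩⟩
  · exact rpow_apply_eigenvector hT0 hα (hT n)
  -- A vector orthogonal to the sequence is treated as an eigenvector for `0`, and `0 ^ α = 0`
  -- because `α > 0`.
  · have := rpow_apply_eigenvector hT0 hα (l := 0) (x := x) (by rw [hzero x hx]; simp)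
    rw [this, Real.zero_rpow hα.ne']
    simp

lemma mu_le_mu (hanti : Antitone fun n => mu A (n + 1)) {m n : ℕ} (hm : 1 ≤ m) (hmn : m ≤ n) :
    mu A n ≤ mu A m := by
  obtain ⟨m, rfl⟩ := Nat.exists_eq_add_of_le' hm
  obtain ⟨n, rfl⟩ := Nat.exists_eq_add_of_le' (hm.trans hmn)
  exact hanti (Nat.le_of_succ_le_succ hmn)

lemma mu_pos (hpos : ∀ n, 0 < mu A (n + 1)) {n : ℕ} (hn : 1 ≤ n) : 0 < mu A n := by
  obtain ⟨n, rfl⟩ := Nat.exists_eq_add_of_le' hn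
  exact hpos n

lemma monotoneOn_fA (hanti : Antitone fun n => mu A (n + 1)) (hpos : ∀ n, 0 < mu A (n + 1)) :
    MonotoneOn (fA A) (Set.Ici 0) := by
  intro s hs t ht hst
  -- For `u ≥ 0` the index is at least 1, so the meaningless `mu A 0` is avoided.
  have h1 : ∀ u : ℝ, 0 ≤ u → 1 ≤ ⌊Real.exp u⌋₊ := fun u hu =>
    Nat.le_floor (by simpa using hu)
  have h2 := mu_le_mu hanti (h1 s hs) (Nat.floor_le_floor (Real.exp_le_exp.2 hst))
  exact neg_le_neg (Real.log_le_log (mu_pos hpos (h1 t ht)) h2)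

lemma fA_log {n : ℕ} (hn : 1 ≤ n) : fA A (Real.log n) = -Real.log (mu A n) := by
  rw [fA, muFun, Real.exp_log (by exact_mod_cast hn), Nat.floor_natCast]

lemma ord_eq : ord A = liminf (fun n : ℕ =>
    ENNReal.ofReal (fA A (Real.log n) / Real.log n)) atTop := by
  refine liminf_congr ?_
  filter_upwards [eventually_ge_atTop 1] with n hn
  rw [fA_log hn, one_div, Real.log_inv, div_neg, neg_div]

lemma tendsto_log_natCast : Tendsto (fun n : ℕ => Real.log n) atTop atTop :=
  Real.tendsto_log_atTop.comp tendsto_natCast_atTop_atTop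

lemma ord_le_upperGrowth (hf : MonotoneOn (fA A) (Set.Ici 0)) {h : ℝ} (hh : 0 < h) :
    ord A ≤ upperGrowth (fA A) h := by
  rw [ord_eq]
  calc _ ≤ limsup (fun n : ℕ => ENNReal.ofReal (fA A (Real.log n) / Real.log n)) atTop :=
        liminf_le_limsup
    _ ≤ limsup (fun t : ℝ => ENNReal.ofReal (fA A t / t)) atTop := by
        rw [limsup, limsup, ← Function.comp_def (fun t : ℝ => ENNReal.ofReal (fA A t / t)),
          ← Filter.map_map]
        exact limsSup_le_limsSup_of_le (Filter.map_mono tendsto_log_natCast)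
    _ ≤ _ := limsup_div_self_le_upperGrowth hf hh

lemma lowerGrowth_le_ord (hf : MonotoneOn (fA A) (Set.Ici 0)) {h : ℝ} (hh : 0 < h) :
    lowerGrowth (fA A) h ≤ ord A := by
  rw [ord_eq]
  calc _ ≤ liminf (fun t : ℝ => ENNReal.ofReal (fA A t / t)) atTop :=
        lowerGrowth_le_liminf_div_self hf hh
    _ ≤ _ := by
        rw [liminf, liminf, ← Function.comp_def (fun t : ℝ => ENNReal.ofReal (fA A t / t)),
          ← Filter.map_map]
        exact limsInf_le_limsInf_of_le (Filter.map_mono tendsto_log_natCast)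

lemma rpow_neg_mul_mu_le (hpos : ∀ n, 0 < mu A (n + 1)) {c : ℝ} {n k : ℕ} (hn : 1 ≤ n)
    (hk : 1 ≤ k) (h : fA A (Real.log n + Real.log k) - fA A (Real.log n) ≤ c * Real.log k) :
    (k : ℝ) ^ (-c) * mu A n ≤ mu A (n * k) := by
  have hn' : (n : ℝ) ≠ 0 := by positivity
  have hk' : (0 : ℝ) < k := by positivity
  have hnk : 1 ≤ n * k := Nat.mul_pos hn hk
  rw [← Real.log_mul hn' hk'.ne', ← Nat.cast_mul, fA_log hnk, fA_log hn] at h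
  have h1 := mu_pos hpos hn
  rw [← Real.log_le_log_iff (by positivity) (mu_pos hpos hnk),
    Real.log_mul (by positivity) h1.ne', Real.log_rpow hk']
  linarith

lemma mu_le_rpow_neg_mul (hpos : ∀ n, 0 < mu A (n + 1)) {c : ℝ} {n k : ℕ} (hn : 1 ≤ n)
    (hk : 1 ≤ k) (h : c * Real.log k ≤ fA A (Real.log n + Real.log k) - fA A (Real.log n)) :
    mu A (n * k) ≤ (k : ℝ) ^ (-c) * mu A n := by
  have hn' : (n : ℝ) ≠ 0 := by positivity
  have hk' : (0 : ℝ) < k := by positivity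
  have hnk : 1 ≤ n * k := Nat.mul_pos hn hk
  rw [← Real.log_mul hn' hk'.ne', ← Nat.cast_mul, fA_log hnk, fA_log hn] at h
  have h1 := mu_pos hpos hn
  rw [← Real.log_le_log_iff (mu_pos hpos hnk) (by positivity),
    Real.log_mul (by positivity) h1.ne', Real.log_rpow hk']
  linarith

lemma le_log_of_ceil_exp_le {t : ℝ} {n : ℕ} (h : ⌈Real.exp t⌉₊ ≤ n) : t ≤ Real.log n := by
  have h1 : Real.exp t ≤ n := Nat.ceil_le.1 h
  exact (Real.le_log_iff_exp_le ((Real.exp_pos t).trans_le h1)).2 h1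

lemma inv_ofReal_le_of_tendsto_upperGrowth (hA : IsCompactOperator A)
    (hrank : ¬ FiniteDimensional ℂ (LinearMap.range (A : H →ₗ[ℂ] H))) {L : ℝ≥0∞}
    (hL : Tendsto (upperGrowth (fA A)) atTop (𝓝 L)) {α : ℝ}
    (hα : IsExponentOfSingularTraceability A α) : (ENNReal.ofReal α)⁻¹ ≤ L := by
  obtain ⟨hα0, τ, hτ, hτ1⟩ := hα
  obtain ⟨e, hanti, hpos, hdiag⟩ := exists_eigenvector_expansion hA hrank
  by_contra! hlt
  obtain ⟨x, hLx, hx⟩ := exists_between hlt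
  obtain ⟨c, hc0, rfl⟩ : ∃ c : ℝ, 0 ≤ c ∧ ENNReal.ofReal c = x :=
    ⟨x.toReal, ENNReal.toReal_nonneg, ENNReal.ofReal_toReal hx.ne_top⟩
  rw [← ENNReal.ofReal_inv_of_pos hα0] at hx
  have hcα : c * α < 1 :=
    (lt_div_iff₀ hα0).1 (by rw [one_div]; exact (ENNReal.ofReal_lt_ofReal_iff'.1 hx).1)
  obtain ⟨k, hk1, hk⟩ := ((eventually_gt_atTop 1).and
    (tendsto_log_natCast.eventually (hL.eventually (gt_mem_nhds hLx)))).exists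
  have hk0 : (0 : ℝ) < k := by exact_mod_cast (zero_lt_one.trans hk1)
  have hk1' : (1 : ℝ) < k := by exact_mod_cast hk1
  obtain ⟨t₀, -, ht₀⟩ := exists_step_le_of_upperGrowth_lt (Real.log_pos hk1') hk
  have key := (hdiag α hα0).mul_le_one_of_eventually_le
    (fun n => Real.rpow_nonneg (hpos n).le _) hτ hτ1 (zero_lt_one.trans hk1)
    (c := ((k : ℝ) ^ (-c * α)).toNNReal) (N := k * ⌈Real.exp t₀⌉₊) fun m hm => by
      have h1 : ⌈Real.exp t₀⌉₊ ≤ m / k + 1 :=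
        ((Nat.le_div_iff_mul_le (zero_lt_one.trans hk1)).2 (by rwa [mul_comm])).trans
          (Nat.le_succ _)
      have h2 := rpow_neg_mul_mu_le hpos (Nat.le_add_left 1 (m / k)) hk1.le
        (ht₀ _ (le_log_of_ceil_exp_le h1))
      -- Rounding is harmless here: `m + 1 ≤ (m / k + 1) * k`, and `μ` is nonincreasing.
      have h3 : mu A ((m / k + 1) * k) ≤ mu A (m + 1) :=
        mu_le_mu hanti (Nat.le_add_left 1 m) (Nat.lt_mul_of_div_lt (Nat.lt_succ_self _)
          (zero_lt_one.trans hk1))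
      have h4 := Real.rpow_le_rpow (mul_nonneg (by positivity) (hpos (m / k)).le) (h2.trans h3)
        hα0.le
      rwa [Real.mul_rpow (by positivity) (hpos (m / k)).le, ← Real.rpow_mul hk0.le,
        ← Real.coe_toNNReal ((k : ℝ) ^ (-c * α)) (by positivity)] at h4
  have key' : (k : ℝ) ^ (-c * α) * k ≤ 1 := by
    have : ((((k : ℝ) ^ (-c * α)).toNNReal * k : ℝ≥0) : ℝ) ≤ 1 := by exact_mod_cast key
    rwa [NNReal.coe_mul, Real.coe_toNNReal _ (by positivity), NNReal.coe_natCast] at this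
  rw [← Real.rpow_add_one hk0.ne'] at key'
  exact absurd key' (not_le.2 (Real.one_lt_rpow hk1' (by linarith)))

lemma le_inv_ofReal_of_tendsto_lowerGrowth (hA : IsCompactOperator A)
    (hrank : ¬ FiniteDimensional ℂ (LinearMap.range (A : H →ₗ[ℂ] H))) {L : ℝ≥0∞}
    (hL : Tendsto (lowerGrowth (fA A)) atTop (𝓝 L)) {α : ℝ}
    (hα : IsExponentOfSingularTraceability A α) : L ≤ (ENNReal.ofReal α)⁻¹ := by
  obtain ⟨hα0, τ, hτ, hτ1⟩ := hα
  obtain ⟨e, hanti, hpos, hdiag⟩ := exists_eigenvector_expansion hA hrank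
  by_contra! hlt
  obtain ⟨x, hx, hLx⟩ := exists_between hlt
  obtain ⟨c, hc0, rfl⟩ : ∃ c : ℝ, 0 ≤ c ∧ ENNReal.ofReal c = x :=
    ⟨x.toReal, ENNReal.toReal_nonneg, ENNReal.ofReal_toReal hLx.ne_top⟩
  rw [← ENNReal.ofReal_inv_of_pos hα0] at hx
  have hcα : 1 < c * α := (inv_lt_iff_one_lt_mul₀ hα0).1 (ENNReal.ofReal_lt_ofReal_iff'.1 hx).1
  -- Requiring `k ^ (c * α - 1) > 2` pays for the extra factor 2 in the ampliation by `2 * k` below.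
  obtain ⟨k, ⟨hk1, hk2⟩, hk⟩ := (((eventually_gt_atTop 1).and
    (((tendsto_rpow_atTop (sub_pos.2 hcα)).comp tendsto_natCast_atTop_atTop).eventually_gt_atTop
      2)).and (tendsto_log_natCast.eventually (hL.eventually (lt_mem_nhds hLx)))).exists
  have hkpos : 0 < k := zero_lt_one.trans hk1
  have hk0 : (0 : ℝ) < k := by exact_mod_cast hkpos
  have hk1' : (1 : ℝ) < k := by exact_mod_cast hk1
  obtain ⟨t₀, -, ht₀⟩ := exists_le_step_of_lt_lowerGrowth (Real.log_pos hk1') hk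
  have key := (hdiag α hα0).one_le_mul_of_eventually_le
    (fun n => Real.rpow_nonneg (hpos n).le _) hτ hτ1 (k := 2 * k) (by positivity)
    (c := ((k : ℝ) ^ (-c * α)).toNNReal) (N := 2 * k * (⌈Real.exp t₀⌉₊ + 1)) fun m hm => by
      have h0 : ⌈Real.exp t₀⌉₊ + 1 ≤ m / (2 * k) :=
        (Nat.le_div_iff_mul_le (by positivity)).2 (by rwa [mul_comm])
      set q := m / (2 * k) with hq
      have h2 := mu_le_rpow_neg_mul hpos (Nat.le_add_left 1 q) hk1.le
        (ht₀ _ (le_log_of_ceil_exp_le (by omega)))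
      have hqm : q * (2 * k) ≤ m := Nat.div_mul_le_self m (2 * k)
      -- With `q = m / k` the index `(q + 1) * k` would not be at most `m` in general. Halving the
      -- quotient gives `(q + 1) * k ≤ 2 * q * k ≤ m` once `q ≥ 1`.
      have h3 : mu A (m + 1) ≤ mu A ((q + 1) * k) := by
        refine mu_le_mu hanti (Nat.mul_pos q.succ_pos hkpos) ?_
        have : 1 * k ≤ q * k := Nat.mul_le_mul_right k (by omega)
        calc (q + 1) * k = q * k + 1 * k := by ring
          _ ≤ q * k + q * k := by omega
          _ = q * (2 * k) := by ring
          _ ≤ m + 1 := by omega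
      have h4 := Real.rpow_le_rpow (hpos m).le (h3.trans h2) hα0.le
      rwa [Real.mul_rpow (by positivity) (hpos q).le, ← Real.rpow_mul hk0.le,
        ← Real.coe_toNNReal ((k : ℝ) ^ (-c * α)) (by positivity)] at h4
  have key' : 1 ≤ (k : ℝ) ^ (-c * α) * (2 * k) := by
    have : 1 ≤ ((((k : ℝ) ^ (-c * α)).toNNReal * (2 * k : ℕ) : ℝ≥0) : ℝ) := by
      exact_mod_cast key
    rw [NNReal.coe_mul, Real.coe_toNNReal _ (by positivity), NNReal.coe_natCast] at this
    exact_mod_cast this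
  have h5 : (k : ℝ) ^ (-c * α) * (2 * k) * (k : ℝ) ^ (c * α - 1) = 2 := by
    have : (k : ℝ) ^ (-c * α) * k * (k : ℝ) ^ (c * α - 1) = 1 := by
      rw [← Real.rpow_add_one hk0.ne', ← Real.rpow_add hk0,
        show -c * α + 1 + (c * α - 1) = 0 by ring, Real.rpow_zero]
    linear_combination 2 * this
  have h6 : (2 : ℝ) < (k : ℝ) ^ (c * α - 1) := hk2
  have h7 := mul_le_mul_of_nonneg_right key' (zero_lt_two.trans h6).le
  rw [h5, one_mul] at h7
  linarith

end Exponents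

end SingularTraces

theorem theorem1p7 {H : Type*} [NormedAddCommGroup H] [InnerProductSpace ℂ H] [CompleteSpace H]
    (A : H →L[ℂ] H) (hA : IsCompactOperator A)
    (hrank : ¬ FiniteDimensional ℂ (LinearMap.range (A : H →ₗ[ℂ] H))) :
    (∃ L : ℝ≥0∞, Tendsto (SingularTraces.upperSlope A) atTop (𝓝 L)) ∧
    (∃ L : ℝ≥0∞, Tendsto (SingularTraces.lowerSlope A) atTop (𝓝 L)) ∧
    (∀ α : ℝ, SingularTraces.IsExponentOfSingularTraceability A α →
      SingularTraces.cLower A ≤ ENNReal.ofReal α ∧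
      ENNReal.ofReal α ≤ SingularTraces.cUpper A) ∧
    SingularTraces.cLower A ≤ (SingularTraces.ord A)⁻¹ ∧
    (SingularTraces.ord A)⁻¹ ≤ SingularTraces.cUpper A := by
  obtain ⟨e, hanti, hpos, -⟩ := SingularTraces.exists_eigenvector_expansion hA hrank
  have hf := SingularTraces.monotoneOn_fA hanti hpos
  have hU := SingularTraces.tendsto_upperGrowth hf
  have hV := SingularTraces.tendsto_lowerGrowth hf
  -- `limUnder` is meaningful only now that convergence is known; `upperSlope A` unfolds to
  -- `upperGrowth (fA A)`.
  have hc : SingularTraces.cLower A = (limsup (SingularTraces.upperGrowth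
      (SingularTraces.fA A)) atTop)⁻¹ := congrArg (·⁻¹) hU.limUnder_eq
  have hc' : SingularTraces.cUpper A = (liminf (SingularTraces.lowerGrowth
      (SingularTraces.fA A)) atTop)⁻¹ := congrArg (·⁻¹) hV.limUnder_eq
  rw [hc, hc']
  refine ⟨⟨_, hU⟩, ⟨_, hV⟩, fun α hα => ⟨?_, ?_⟩, ?_, ?_⟩
  · exact ENNReal.inv_le_iff_inv_le.1
      (SingularTraces.inv_ofReal_le_of_tendsto_upperGrowth hA hrank hU hα)
  · exact ENNReal.le_inv_iff_le_inv.1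
      (SingularTraces.le_inv_ofReal_of_tendsto_lowerGrowth hA hrank hV hα)
  · refine ENNReal.inv_le_inv.2 (ge_of_tendsto hU ?_)
    filter_upwards [eventually_gt_atTop 0] with h hh using
      SingularTraces.ord_le_upperGrowth hf hh
  · refine ENNReal.inv_le_inv.2 (le_of_tendsto hV ?_)
    filter_upwards [eventually_gt_atTop 0] with h hh using
      SingularTraces.lowerGrowth_le_ord hf hh
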